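/- Let $q$ be a fixed prime power and let $\mathbb{F}_q$ be the field with $q$ elements. For each $n$, let $v_1,v_2,\dots$ be independent uniformly random vectors in $\mathbb{F}_q^n$, let $A_m=[v_1,\dots,v_m]$ be the $n\times m$ matrix with columns $v_1,\dots,v_m$, and let $M[A_m]$ be the matroid on the column indices $\{1,\dots,m\}$ in which a set of indices is independent if and only if the corresponding family of columns is linearly independent. A circuit is a minimal dependent set, and its length is its number of elements. Then, with all limits taken as $n\to\infty$: (a) The first circuit appearing in the process has length asymptotic to $(1-1/q)n$, asymptotically almost surely. That is, for every $\varepsilon>0$, with probability tending to $1$, at the smallest step $m$ at which $M[A_m]$ has a circuit, it has exactly one circuit $C$, and $$\bigl|\,|C|-(1-1/q)n\,\bigr|\le \varepsilon\,(1-1/q)n .$$ (b) The first Hamilton circuit (that is, circuit of length $n$) appears in fewer than $2n$ steps, asymptotically almost surely: if $\tau$ is the minimum $m$ such that $M[A_m]$ has a circuit of length $n$ (with $\tau=\infty$ if there is none), then $\Pr(\tau<2n)\to 1$. This holds for every prime power $q$. -/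

import Mathlib

open MeasureTheory ProbabilityTheory Filter Topology

/-- The augmentation property of linear independence among the members of a finite family. -/
theorem linearIndepOn_augment {F V α : Type*} [Field F] [AddCommGroup V] [Module F V] [Finite α]
    (c : α → V) {I J : Set α} (hI : LinearIndepOn F c I) (hJ : LinearIndepOn F c J)
    (hlt : I.ncard < J.ncard) : ∃ e ∈ J, e ∉ I ∧ LinearIndepOn F c (insert e I) := by
  classical
  by_contra! hcon
  have hspan : Submodule.span F (c '' J) ≤ Submodule.span F (c '' I) := by
    rw [Submodule.span_le]
    rintro _ ⟨e, he, rfl⟩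
    by_cases heI : e ∈ I
    · exact Submodule.subset_span ⟨e, heI, rfl⟩
    · by_contra hne
      exact hcon e he heI ((linearIndepOn_insert heI).2 ⟨hI, hne⟩)
  have : Fintype α := Fintype.ofFinite α
  have hdim : ∀ S : Set α, LinearIndepOn F c S →
      Module.finrank F (Submodule.span F (c '' S)) = S.ncard := by
    intro S hS
    have h := finrank_span_eq_card hS
    rw [← Set.image_eq_range] at h
    rw [h, ← Nat.card_coe_set_eq, Nat.card_eq_fintype_card]
  have : FiniteDimensional F (Submodule.span F (c '' I)) :=
    FiniteDimensional.span_of_finite F (Set.toFinite _)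
  have hle := Submodule.finrank_mono hspan
  rw [hdim I hI, hdim J hJ] at hle
  omega

/-- The matroid `M[A]` represented by a matrix `A`: its elements are the column indices of `A`,
and a set of indices is independent when the family of the corresponding columns is linearly
independent. -/
def Matrix.columnMatroid {F ι α : Type*} [Field F] [Finite α] (A : Matrix ι α F) : Matroid α :=
  (IndepMatroid.ofFinite (E := Set.univ) Set.finite_univ (fun I => LinearIndepOn F A.col I)
    (linearIndepOn_empty F A.col) (fun _ _ hJ hIJ => hJ.mono hIJ)
    (fun _ _ hI hJ hlt => linearIndepOn_augment A.col hI hJ hlt)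
    (fun I _ => Set.subset_univ I)).matroid

/-- The `n × m` matrix `A_m` whose columns are the first `m` vectors of the sequence `w`. -/
def firstColumns {F : Type*} {n : ℕ} (w : ℕ → Fin n → F) (m : ℕ) : Matrix (Fin n) (Fin m) F :=
  Matrix.of fun r j => w j r

/-- `C` is the first circuit of the matroid process `M[A_0], M[A_1], M[A_2], …` of the sequence
`w`, and it appears at step `m`: it is the one and only circuit of `M[A_m]`, and there is no
circuit at any earlier step. -/
def IsFirstCircuit {F : Type*} [Field F] {n : ℕ} (w : ℕ → Fin n → F) (m : ℕ)
    (C : Set (Fin m)) : Prop :=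
  (∀ D : Set (Fin m), (firstColumns w m).columnMatroid.IsCircuit D ↔ D = C) ∧
    ∀ m' < m, ∀ D : Set (Fin m'), ¬ (firstColumns w m').columnMatroid.IsCircuit D

/-- The minimum `m` such that `M[A_m]` has a circuit of length `k` (infinite if there is none). -/
noncomputable def circuitTime {F : Type*} [Field F] {n : ℕ} (w : ℕ → Fin n → F) (k : ℕ) : ℕ∞ :=
  ⨅ (m : ℕ) (_ : ∃ C : Set (Fin m), (firstColumns w m).columnMatroid.IsCircuit C ∧ C.ncard = k),
    (m : ℕ∞)

/-! Both events depend on a bounded initial segment of the process, which is uniform on a finite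
space, so it suffices to count bad families. Write `q` for the field size.

(a) Among `n + 1` vectors there is a first one, `w j = ∑ x i • w i`, depending on its independent
predecessors; the circuit is `j` together with the support of `x`, of length `1 + hammingNorm x`. A
fixed relation holds with probability `q ^ (-n)`. By Chebyshev, at most about a fraction `(n + (n -
j) ^ 2) / d ^ 2` of the `q ^ j` vectors `x` gives a length more than `d` away from `(1 - 1/q) n`. In
the union bound the factor `q ^ (j - n)` makes the sum over `j` geometric, so the total is at most
`(2 n + 12) / d ^ 2`, which is `O(1/n)` for `d` proportional to `n`.

(b) Apply the second moment method to the circuits among the `n`-subsets of `2 n - 1` vectors. Each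
is a circuit with probability `p ≥ 1 / (q 2 ^ n)`. For `S ≠ T` the two events are independent given
that `S ∩ T` is independent, because the linear group is transitive on independent families; hence
their joint probability is at most `p ^ 2 (1 + 2 * 2 ^ (-|S \ T|))`. For fixed `S` the sum of `2 ^
(-|S \ T|)` over `T` is at most `3 ^ n`, so the probability of no such circuit is at most `(q 2 ^ n
+ 2 * 3 ^ n) / (2 n - 1).choose n`. The binomial is at least `4 ^ n / (4 n)`, and `3 < 4` finishes
the argument. The key lemmas are `card_isCircuitOn_inter_mul` and `card_forall_notMem_mul_sq_le`. -/

/-- The first `N` members of an independent sequence of uniform variables are jointly uniform. -/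
theorem hasLaw_prefix_uniform {V Ω : Type*} [Finite V] [MeasurableSpace V]
    [MeasurableSingletonClass V] [MeasurableSpace Ω] {P : Measure Ω}
    {v : ℕ → Ω → V} (hlaw : ∀ i, HasLaw (v i) (uniformOn Set.univ) P)
    (hindep : iIndepFun v P) (N : ℕ) :
    HasLaw (fun ω (i : Fin N) => v i ω) (uniformOn Set.univ) P := by
  have h := iIndepFun.hasLaw_pi (X := fun (i : Fin N) => v i)
    (μ := fun _ => uniformOn Set.univ) (fun i => hlaw i)
    (hindep.precomp (g := fun i : Fin N => (i : ℕ)) Fin.val_injective)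
  rw [← uniformOn_pi, Set.pi_univ] at h
  exact h

/-- A uniform variable on a finite type avoids a small set with large probability. -/
theorem one_sub_le_measure_notMem {α Ω : Type*} [Fintype α] [Nonempty α] [MeasurableSpace α]
    [MeasurableSingletonClass α] [MeasurableSpace Ω] {P : Measure Ω} [IsProbabilityMeasure P]
    {Y : Ω → α} (hY : HasLaw Y (uniformOn Set.univ) P) (B : Finset α) {r : ℝ}
    (hB : (B.card : ℝ) ≤ r * Fintype.card α) :
    1 - ENNReal.ofReal r ≤ P {ω | Y ω ∉ B} := by
  classical
  have hmB : MeasurableSet (B : Set α) := B.measurableSet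
  have h1 : P (Y ⁻¹' B) = uniformOn Set.univ (B : Set α) := by
    rw [← hY.map_eq, Measure.map_apply_of_aemeasurable hY.aemeasurable hmB]
  have h2 : P (Y ⁻¹' B) ≤ ENNReal.ofReal r := by
    rw [h1, uniformOn_univ, Measure.count_apply_finset]
    have hpos : (0 : ℝ) < Fintype.card α := by exact_mod_cast Fintype.card_pos
    rw [← ENNReal.ofReal_natCast, ← ENNReal.ofReal_natCast, ← ENNReal.ofReal_div_of_pos hpos]
    exact ENNReal.ofReal_le_ofReal ((div_le_iff₀ hpos).2 hB)
  -- Subadditivity suffices here, so the two events need not be measurable.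
  have h3 : (1 : ENNReal) ≤ P {ω | Y ω ∉ B} + P (Y ⁻¹' B) := by
    rw [← measure_univ (μ := P)]
    refine (measure_mono ?_).trans (measure_union_le _ _)
    intro ω _
    by_cases h : Y ω ∈ B
    · exact Or.inr h
    · exact Or.inl h
  exact tsub_le_iff_right.2 (h3.trans (by gcongr))

/-- Events that contain all but a vanishing proportion of the initial segments of the sequence have
probability tending to one. -/
theorem tendsto_measure_one_of_card_le {F : Type*} [Fintype F] [Nonempty F]
    [MeasurableSpace F] [MeasurableSingletonClass F]
    {Ω : ℕ → Type*} [∀ n, MeasurableSpace (Ω n)]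
    {P : ∀ n, Measure (Ω n)} [∀ n, IsProbabilityMeasure (P n)]
    {v : ∀ n, ℕ → Ω n → (Fin n → F)}
    (hlaw : ∀ n i, HasLaw (v n i) (uniformOn Set.univ) (P n))
    (hindep : ∀ n, iIndepFun (v n) (P n))
    (G : ∀ n, Set (Ω n)) (N : ℕ → ℕ) (B : ∀ n, Finset (Fin (N n) → Fin n → F)) (r : ℕ → ℝ)
    (hG : ∀ᶠ n in atTop, ∀ ω, (fun i : Fin (N n) => v n i ω) ∉ B n → ω ∈ G n)
    (hB : ∀ᶠ n in atTop, ((B n).card : ℝ) ≤ r n * Fintype.card (Fin (N n) → Fin n → F))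
    (hr : Tendsto r atTop (𝓝 0)) :
    Tendsto (fun n => P n (G n)) atTop (𝓝 1) := by
  have hlim : Tendsto (fun n => 1 - ENNReal.ofReal (r n)) atTop (𝓝 1) := by
    have h := ENNReal.Tendsto.sub (tendsto_const_nhds (x := (1 : ENNReal)))
      (ENNReal.tendsto_ofReal hr) (Or.inl ENNReal.one_ne_top)
    simpa using h
  refine tendsto_of_tendsto_of_tendsto_of_le_of_le' hlim tendsto_const_nhds ?_
    (Eventually.of_forall fun n => prob_le_one)
  filter_upwards [hB, hG] with n hn hGn
  exact (one_sub_le_measure_notMem (hasLaw_prefix_uniform (hlaw n) (hindep n) (N n)) (B n)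
    hn).trans (measure_mono fun ω hω => hGn ω hω)

/-! ### The first circuit as the support of the first dependency -/

theorem Matrix.columnMatroid_indep_iff {F ι α : Type*} [Field F] [Finite α] (A : Matrix ι α F)
    (I : Set α) : A.columnMatroid.Indep I ↔ LinearIndepOn F A.col I := Iff.rfl

theorem Matrix.columnMatroid_ground {F ι α : Type*} [Field F] [Finite α] (A : Matrix ι α F) :
    A.columnMatroid.E = Set.univ := rfl

theorem firstColumns_col {F : Type*} {n : ℕ} (w : ℕ → Fin n → F) (m : ℕ) :
    (firstColumns w m).col = fun i : Fin m => w i := rfl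

/-- When independent vectors are extended by a linear combination of them, dropping the `i`-th of
them leaves an independent family if and only if its coefficient is nonzero. -/
theorem notMem_span_image_ne_iff {F V ι : Type*} [Field F] [AddCommGroup V] [Module F V]
    [Fintype ι] {u : ι → V} (hu : LinearIndependent F u) (x : ι → F) (i : ι) :
    ∑ k, x k • u k ∉ Submodule.span F (u '' {k | k ≠ i}) ↔ x i ≠ 0 := by
  classical
  have hrest : ∑ k ∈ Finset.univ.erase i, x k • u k ∈ Submodule.span F (u '' {k | k ≠ i}) :=
    Submodule.sum_mem _ fun k hk => Submodule.smul_mem _ _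
      (Submodule.subset_span ⟨k, Finset.ne_of_mem_erase hk, rfl⟩)
  rw [← Finset.add_sum_erase _ _ (Finset.mem_univ i), Submodule.add_mem_iff_left _ hrest]
  have hi : u i ∉ Submodule.span F (u '' {k | k ≠ i}) := hu.notMem_span_image (by simp)
  by_cases hx : x i = 0
  · simp [hx]
  · rw [Submodule.smul_mem_iff _ hx]
    simp [hx, hi]

/-- The first circuit is the support of the first linear dependency. -/
theorem exists_isFirstCircuit_of_eq_sum {F : Type*} [Field F] [DecidableEq F] {n : ℕ}
    (w : ℕ → Fin n → F) (j : ℕ) (hI : LinearIndependent F (fun i : Fin j => w i)) (x : Fin j → F)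
    (hx : w j = ∑ i, x i • w i) :
    ∃ C : Set (Fin (j + 1)), IsFirstCircuit w (j + 1) C ∧ C.ncard = 1 + hammingNorm x := by
  classical
  set M := (firstColumns w (j + 1)).columnMatroid with hM
  set I : Set (Fin (j + 1)) := Set.range Fin.castSucc with hIdef
  have hcol : (firstColumns w (j + 1)).col ∘ Fin.castSucc = fun i : Fin j => w i := by
    ext i; simp [firstColumns_col]
  have hlast : (firstColumns w (j + 1)).col (Fin.last j) = w j := by simp [firstColumns_col]
  have hMI : M.Indep I := by
    rw [hM, Matrix.columnMatroid_indep_iff, hIdef,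
      linearIndepOn_range_iff (Fin.castSucc_injective j), hcol]
    exact hI
  have hlI : Fin.last j ∉ I := by simp [hIdef]
  have huniv : insert (Fin.last j) I = Set.univ := by
    ext i
    refine Fin.lastCases ?_ (fun i => ?_) i <;> simp [hIdef]
  have hdep : ¬ M.Indep Set.univ := by
    rw [← huniv, hM, Matrix.columnMatroid_indep_iff, linearIndepOn_insert hlI, hlast, hx]
    refine fun h => h.2 (Submodule.sum_mem _ fun i _ => Submodule.smul_mem _ _
      (Submodule.subset_span ⟨i.castSucc, ⟨i, rfl⟩, ?_⟩))
    simp [firstColumns_col]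
  have hcl : Fin.last j ∈ M.closure I := by
    rw [hMI.mem_closure_iff]
    exact Or.inl ⟨huniv ▸ hdep, by rw [hM, Matrix.columnMatroid_ground]; exact Set.subset_univ _⟩
  -- Adding one spanned element to an independent set creates exactly one circuit, the fundamental
  -- one.
  refine ⟨M.fundCircuit (Fin.last j) I, ⟨fun D => ⟨fun hD => ?_, fun hD => ?_⟩, ?_⟩, ?_⟩
  · exact hD.eq_fundCircuit_of_subset hMI (huniv ▸ Set.subset_univ _)
  · rw [hD]
    exact hMI.fundCircuit_isCircuit hcl hlI
  · intro m' hm' D hD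
    refine hD.not_indep ?_
    rw [Matrix.columnMatroid_indep_iff, firstColumns_col]
    refine LinearIndependent.linearIndepOn ?_ _
    exact hI.comp (Fin.castLE (Nat.lt_succ_iff.1 hm')) (Fin.castLE_injective _)
  · have hC : M.fundCircuit (Fin.last j) I
        = insert (Fin.last j) ↑(Finset.map Fin.castSuccEmb {i | x i ≠ 0}) := by
      ext k
      -- An index lies in the fundamental circuit iff exchanging it for the last one preserves
      -- independence, that is, iff its coefficient is nonzero.
      rw [hMI.mem_fundCircuit_iff hcl hlI]
      refine Fin.lastCases ?_ (fun i => ?_) k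
      · rw [Set.insert_sdiff_of_mem _ (Set.mem_singleton _)]
        simpa using hMI.subset Set.sdiff_subset
      · have hne : Fin.last j ∉ ({i.castSucc} : Set _) := by simp [Fin.ext_iff, i.2.ne']
        have him : (firstColumns w (j + 1)).col '' (I \ {i.castSucc})
            = (fun i : Fin j => w i) '' {k | k ≠ i} := by
          rw [hIdef, ← hcol, Set.image_comp]
          congr 1
          ext k
          refine Fin.lastCases ?_ (fun k => ?_) k <;> simp
        rw [Set.insert_sdiff_of_notMem _ hne, hM, Matrix.columnMatroid_indep_iff,
          linearIndepOn_insert (fun h => hlI h.1), hlast, him, hx, notMem_span_image_ne_iff hI,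
          and_iff_right (LinearIndepOn.mono hMI Set.sdiff_subset)]
        simp
    rw [hC, ← Finset.coe_insert, Set.ncard_coe_finset, Finset.card_insert_of_notMem (by simp),
      Finset.card_map, add_comm]
    rfl

/-- Among the first `n + 1` vectors there is a first one that depends on its predecessors. -/
theorem exists_first_dependency {F : Type*} [Field F] {n : ℕ} (w : ℕ → Fin n → F) :
    ∃ j ≤ n, LinearIndependent F (fun i : Fin j => w i) ∧
      ∃ x : Fin j → F, w j = ∑ i, x i • w i := by
  classical
  have hex : ¬ LinearIndependent F (fun i : Fin (n + 1) => w i) := fun h => by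
    have := h.fintype_card_le_finrank
    simp at this
  have hex' : ∃ m : ℕ, ¬ LinearIndependent F (fun i : Fin m => w i) := ⟨_, hex⟩
  obtain ⟨m, hm, hmin⟩ : ∃ m : ℕ, ¬ LinearIndependent F (fun i : Fin m => w i) ∧
      ∀ k < m, LinearIndependent F (fun i : Fin k => w i) :=
    ⟨Nat.find hex', Nat.find_spec hex', fun k hk => not_not.1 (Nat.find_min hex' hk)⟩
  obtain _ | j := m
  · exact absurd (linearIndependent_empty_type) hm
  have hj := hmin j (Nat.lt_succ_self j)
  refine ⟨j, ?_, hj, ?_⟩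
  · have := hj.fintype_card_le_finrank
    simpa using this
  · rw [linearIndependent_finSucc'] at hm
    have hinit : Fin.init (fun i : Fin (j + 1) => w i) = fun i : Fin j => w i := by
      ext i; simp [Fin.init]
    rw [hinit] at hm
    have hmem : w j ∈ Submodule.span F (Set.range fun i : Fin j => w i) := by
      by_contra h
      exact hm ⟨hj, by simpa using h⟩
    obtain ⟨x, hx⟩ := (Submodule.mem_span_range_iff_exists_fun F).1 hmem
    exact ⟨x, hx.symm⟩

/-! ### Counting families whose first circuit has deviating length -/

/-- The second moment of the Hamming weight of a uniform vector about an arbitrary point. -/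
theorem sum_hammingNorm_sub_sq {F : Type*} [Field F] [Fintype F] [DecidableEq F] (j : ℕ) (a : ℝ) :
    ∑ x : Fin j → F, ((hammingNorm x : ℝ) - a) ^ 2 =
      (Fintype.card F : ℝ) ^ j * (j * ((1 - (Fintype.card F : ℝ)⁻¹) * (Fintype.card F : ℝ)⁻¹)
        + (j * (1 - (Fintype.card F : ℝ)⁻¹) - a) ^ 2) := by
  have hq : (Fintype.card F : ℝ) ≠ 0 := by exact_mod_cast Fintype.card_ne_zero
  -- Split off the first coordinate: the value `0` keeps the centre `a`, and each of the `q - 1`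
  -- nonzero values moves it to `a - 1`.
  induction j generalizing a with
  | zero => simp [hammingNorm]
  | succ j ih =>
    have hcons : ∀ (c : F) (x : Fin j → F), (hammingNorm (Fin.cons c x : Fin (j + 1) → F) : ℝ)
        = (if c = 0 then 0 else 1) + hammingNorm x := by
      intro c x
      simp only [hammingNorm, Finset.card_filter, Fin.sum_univ_succ, Fin.cons_zero, Fin.cons_succ]
      by_cases h : c = 0 <;> simp [h]
    rw [← (Fin.consEquiv fun _ : Fin (j + 1) => F).sum_comp, Fintype.sum_prod_type,
      ← Finset.add_sum_erase _ _ (Finset.mem_univ (0 : F))]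
    have h0 : ∑ x : Fin j → F, ((hammingNorm (Fin.consEquiv (fun _ : Fin (j + 1) => F) (0, x)) : ℝ)
        - a) ^ 2 = ∑ x : Fin j → F, ((hammingNorm x : ℝ) - a) ^ 2 := by
      refine Finset.sum_congr rfl fun x _ => ?_
      have := hcons 0 x
      simp only [Fin.consEquiv, Equiv.coe_fn_mk]
      rw [this]; simp
    have h1 : ∀ c ∈ Finset.univ.erase (0 : F),
        ∑ x : Fin j → F, ((hammingNorm (Fin.consEquiv (fun _ : Fin (j + 1) => F) (c, x)) : ℝ)
        - a) ^ 2 = ∑ x : Fin j → F, ((hammingNorm x : ℝ) - (a - 1)) ^ 2 := by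
      intro c hc
      refine Finset.sum_congr rfl fun x _ => ?_
      have := hcons c x
      simp only [Fin.consEquiv, Equiv.coe_fn_mk]
      rw [this, if_neg (Finset.ne_of_mem_erase hc)]; ring
    rw [h0, Finset.sum_congr rfl h1, Finset.sum_const, Finset.card_erase_of_mem (Finset.mem_univ _),
      nsmul_eq_mul, Finset.card_univ, Nat.cast_sub Fintype.card_pos, ih, ih]
    push_cast
    field_simp
    ring

theorem card_filter_map_eq_zero_mul {F V E : Type*} [Field F] [Fintype V] [DecidableEq V]
    [AddCommGroup V] [Module F V] [Fintype E] [AddCommGroup E] [Module F E] (L : E →ₗ[F] V)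
    (hL : Function.Surjective L) :
    (Finset.univ.filter fun A : E => L A = 0).card * Fintype.card V = Fintype.card E := by
  have hcard := Submodule.card_eq_card_quotient_mul_card (LinearMap.ker L)
  rw [Nat.card_congr (L.quotKerEquivOfSurjective hL).toEquiv, Nat.card_eq_fintype_card,
    Nat.card_eq_fintype_card (α := V)] at hcard
  rw [hcard]
  congr 1
  rw [Nat.subtype_card]
  intro A
  simp

/-- The families that satisfy a prescribed nontrivial linear relation. -/
theorem card_filter_sum_smul_eq_zero_mul {F V α : Type*} [Field F] [Fintype V] [DecidableEq V]
    [AddCommGroup V] [Module F V] [Fintype α] [DecidableEq α] (x : α → F) (hx : x ≠ 0) :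
    (Finset.univ.filter fun A : α → V => ∑ i, x i • A i = 0).card * Fintype.card V
      = Fintype.card (α → V) := by
  obtain ⟨i, hi⟩ := Function.ne_iff.1 hx
  let L : (α → V) →ₗ[F] V := ∑ i, x i • LinearMap.proj i
  have hL : ∀ A, L A = ∑ i, x i • A i := by
    intro A; simp [L]
  have hsurj : Function.Surjective L := fun v => by
    refine ⟨Pi.single i ((x i)⁻¹ • v), ?_⟩
    rw [hL, Finset.sum_eq_single i (fun k _ hk => by simp [hk]) (by simp), Pi.single_eq_same,
      smul_inv_smul₀ hi]
  simpa [hL] using card_filter_map_eq_zero_mul L hsurj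

/-- The families that satisfy a prescribed linear relation expressing one member by the
previous ones. -/
theorem card_filter_eq_sum_mul {F V : Type*} [Field F] [Fintype V] [DecidableEq V]
    [AddCommGroup V] [Module F V] {N : ℕ} (j : Fin N) (x : Fin j → F) :
    (Finset.univ.filter fun A : Fin N → V => A j = ∑ i, x i • A (Fin.castLE j.2.le i)).card
      * Fintype.card V = Fintype.card (Fin N → V) := by
  classical
  let L : (Fin N → V) →ₗ[F] V :=
    LinearMap.proj j - ∑ i, x i • LinearMap.proj (Fin.castLE j.2.le i)
  have hL : ∀ A, L A = A j - ∑ i, x i • A (Fin.castLE j.2.le i) := by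
    intro A; simp [L]
  have hne : ∀ i : Fin j, Fin.castLE j.2.le i ≠ j := fun i h => by
    have := congrArg Fin.val h
    simp at this
    omega
  have hsurj : Function.Surjective L := fun v => ⟨Function.update 0 j v, by simp [hL, hne]⟩
  simpa [hL, sub_eq_zero] using card_filter_map_eq_zero_mul L hsurj

/-- The exact remainder makes induction immediate. Only the limit `2 * c + 12` matters later, since
the subtracted term is nonnegative for `c ≥ 0`. -/
theorem sum_half_pow_mul_add_sq (c : ℝ) (N : ℕ) :
    ∑ i ∈ Finset.range N, (1 / 2 : ℝ) ^ i * (c + (1 + i) ^ 2)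
      = 2 * c + 12 - (2 * c + 2 * N ^ 2 + 8 * N + 12) * (1 / 2 : ℝ) ^ N := by
  induction N with
  | zero => simp
  | succ N ih =>
    rw [Finset.sum_range_succ, ih, pow_succ]
    push_cast
    ring

/-- Proportion of the vectors of `F ^ j` whose Hamming weight deviates, weighted by the chance
`q ^ (j - n)` that the `j`-th vector depends on its predecessors. -/
theorem card_deviating_le {F : Type*} [Field F] [Fintype F] [DecidableEq F] {n j : ℕ} (hj : j ≤ n)
    {d : ℝ} (hd : 0 < d) :
    ((Finset.univ.filter fun x : Fin j → F =>
        d < |((1 + hammingNorm x : ℕ) : ℝ) - (1 - (Fintype.card F : ℝ)⁻¹) * n|).card : ℝ)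
      ≤ (Fintype.card F : ℝ) ^ n * ((1 / 2) ^ (n - j) * (n + (1 + (n - j : ℕ)) ^ 2)) / d ^ 2 := by
  set q : ℝ := (Fintype.card F : ℝ) with hqdef
  have hq2 : (2 : ℝ) ≤ q := by
    rw [hqdef]
    exact_mod_cast Fintype.one_lt_card (α := F)
  have hq0 : 0 < q := by linarith
  have hp0 : 0 ≤ q⁻¹ := by positivity
  have hp1 : q⁻¹ ≤ 1 := inv_le_one_of_one_le₀ (by linarith)
  rw [le_div_iff₀ (by positivity)]
  obtain ⟨i, rfl⟩ := Nat.exists_eq_add_of_le hj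
  calc _ = ∑ x ∈ Finset.univ.filter (fun x : Fin j → F =>
        d < |((1 + hammingNorm x : ℕ) : ℝ) - (1 - q⁻¹) * (j + i : ℕ)|), d ^ 2 := by
        rw [Finset.sum_const, nsmul_eq_mul]
    _ ≤ ∑ x ∈ Finset.univ.filter (fun x : Fin j → F =>
        d < |((1 + hammingNorm x : ℕ) : ℝ) - (1 - q⁻¹) * (j + i : ℕ)|),
          ((hammingNorm x : ℝ) - ((1 - q⁻¹) * (j + i : ℕ) - 1)) ^ 2 := by
        -- Chebyshev's inequality; the centre is lowered by one because the closing vector counts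
        -- towards the length.
        refine Finset.sum_le_sum fun x hx => ?_
        have hx := (Finset.mem_filter.1 hx).2
        rw [show (hammingNorm x : ℝ) - ((1 - q⁻¹) * (j + i : ℕ) - 1)
          = ((1 + hammingNorm x : ℕ) : ℝ) - (1 - q⁻¹) * (j + i : ℕ) by push_cast; ring]
        exact (pow_le_pow_left₀ hd.le hx.le 2).trans_eq (sq_abs _)
    _ ≤ ∑ x : Fin j → F, ((hammingNorm x : ℝ) - ((1 - q⁻¹) * (j + i : ℕ) - 1)) ^ 2 :=
        Finset.sum_le_sum_of_subset_of_nonneg (Finset.subset_univ _) fun _ _ _ => sq_nonneg _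
    _ = q ^ j * (j * ((1 - q⁻¹) * q⁻¹) + (1 - (1 - q⁻¹) * i) ^ 2) := by
        rw [sum_hammingNorm_sub_sq]; push_cast; ring
    _ ≤ q ^ j * ((j + i : ℕ) + (1 + i) ^ 2) := by
        have hi : (0 : ℝ) ≤ i := Nat.cast_nonneg i
        have hj0 : (0 : ℝ) ≤ j := Nat.cast_nonneg j
        have h1 : (1 - q⁻¹) * q⁻¹ ≤ 1 := mul_le_one₀ (by linarith) hp0 hp1
        have h2 : (j : ℝ) * ((1 - q⁻¹) * q⁻¹) ≤ j := mul_le_of_le_one_right hj0 h1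
        have h3 : (1 - q⁻¹) * i ≤ i := mul_le_of_le_one_left hi (by linarith)
        have h4 : 0 ≤ (1 - q⁻¹) * i := mul_nonneg (by linarith) hi
        have h5 : (1 - (1 - q⁻¹) * i) ^ 2 ≤ (1 + (i : ℝ)) ^ 2 := by
          rw [sq_le_sq, abs_of_nonneg (by linarith : (0 : ℝ) ≤ 1 + i), abs_le]
          constructor <;> linarith
        refine mul_le_mul_of_nonneg_left ?_ (by positivity)
        push_cast
        linarith
    _ ≤ q ^ (j + i) * ((1 / 2) ^ (j + i - j) * ((j + i : ℕ) + (1 + (j + i - j : ℕ)) ^ 2)) := by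
        -- Since `q ≥ 2`, `(q * (1 / 2)) ^ i ≥ 1`; this replaces `q ^ (-i)` by `(1 / 2) ^ i`, a
        -- weight uniform in `q`.
        rw [Nat.add_sub_cancel_left, pow_add, mul_assoc, ← mul_assoc (q ^ i), ← mul_pow]
        refine mul_le_mul_of_nonneg_left ?_ (by positivity)
        exact le_mul_of_one_le_left (by positivity) (one_le_pow₀ (by linarith))

/-- The families whose first dependency may have a support of deviating size. -/
noncomputable def deviatingFamilies (F : Type*) [Field F] [Fintype F] (n : ℕ) (d : ℝ) :
    Finset (Fin (n + 1) → Fin n → F) :=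
  open Classical in
  Finset.univ.filter fun A => ∃ (j : Fin (n + 1)) (x : Fin j → F),
    d < |((1 + hammingNorm x : ℕ) : ℝ) - (1 - (Fintype.card F : ℝ)⁻¹) * n| ∧
      A j = ∑ i, x i • A (Fin.castLE j.2.le i)

/-- Union bound over `j` and `x`. Since `deviatingFamilies` does not ask the members before `j` to
be independent, each pair contributes exactly a fraction `q ^ (-n)` of all families. -/
theorem card_deviatingFamilies_le (F : Type*) [Field F] [Fintype F] (n : ℕ) {d : ℝ} (hd : 0 < d) :
    ((deviatingFamilies F n d).card : ℝ)
      ≤ (2 * n + 12) / d ^ 2 * Fintype.card (Fin (n + 1) → Fin n → F) := by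
  classical
  set X : ℝ := (Fintype.card (Fin (n + 1) → Fin n → F) : ℝ) with hX
  have hq0 : (0 : ℝ) < Fintype.card F := by exact_mod_cast Fintype.card_pos
  have hqn : (0 : ℝ) < (Fintype.card F : ℝ) ^ n := by positivity
  have hX0 : 0 ≤ X := Nat.cast_nonneg _
  have hrel : ∀ (j : Fin (n + 1)) (x : Fin j → F),
      ((Finset.univ.filter fun A : Fin (n + 1) → Fin n → F =>
        A j = ∑ i, x i • A (Fin.castLE j.2.le i)).card : ℝ) = X / (Fintype.card F : ℝ) ^ n := by
    intro j x
    rw [eq_div_iff hqn.ne', hX, ← card_filter_eq_sum_mul j x]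
    push_cast
    simp
  have hsub : deviatingFamilies F n d ⊆ (Finset.univ : Finset (Fin (n + 1))).biUnion fun j =>
      (Finset.univ.filter fun x : Fin j → F =>
        d < |((1 + hammingNorm x : ℕ) : ℝ) - (1 - (Fintype.card F : ℝ)⁻¹) * n|).biUnion fun x =>
      Finset.univ.filter fun A : Fin (n + 1) → Fin n → F =>
        A j = ∑ i, x i • A (Fin.castLE j.2.le i) := by
    intro A hA
    obtain ⟨j, x, hx, hAx⟩ := (Finset.mem_filter.1 hA).2
    refine Finset.mem_biUnion.2 ⟨j, Finset.mem_univ _, Finset.mem_biUnion.2 ⟨x, ?_, ?_⟩⟩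
    · refine Finset.mem_filter.2 ⟨Finset.mem_univ _, ?_⟩
      convert hx
    · exact Finset.mem_filter.2 ⟨Finset.mem_univ _, hAx⟩
  calc ((deviatingFamilies F n d).card : ℝ)
      ≤ ∑ j : Fin (n + 1), ∑ x ∈ Finset.univ.filter (fun x : Fin j → F =>
          d < |((1 + hammingNorm x : ℕ) : ℝ) - (1 - (Fintype.card F : ℝ)⁻¹) * n|),
            X / (Fintype.card F : ℝ) ^ n := by
        refine (Nat.cast_le.2 ((Finset.card_le_card hsub).trans Finset.card_biUnion_le)).trans ?_
        push_cast
        refine Finset.sum_le_sum fun j _ => ?_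
        refine (Nat.cast_le.2 Finset.card_biUnion_le).trans ?_
        push_cast
        exact le_of_eq (Finset.sum_congr rfl fun x _ => hrel j x)
    _ ≤ ∑ j : Fin (n + 1), X / d ^ 2 * ((1 / 2) ^ (n - j : ℕ) * (n + (1 + (n - j : ℕ)) ^ 2)) := by
        refine Finset.sum_le_sum fun j _ => ?_
        rw [Finset.sum_const, nsmul_eq_mul]
        refine (mul_le_mul_of_nonneg_right (card_deviating_le (Nat.lt_succ_iff.1 j.2) hd)
          (by positivity)).trans (le_of_eq ?_)
        field_simp
    _ = X / d ^ 2 * ∑ i ∈ Finset.range (n + 1), (1 / 2 : ℝ) ^ i * (n + (1 + i) ^ 2) := by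
        -- Reindex by the codimension `i = n - j`.
        rw [← Finset.mul_sum, Fin.sum_univ_eq_sum_range
          (fun j => (1 / 2 : ℝ) ^ (n - j) * (n + (1 + (n - j : ℕ)) ^ 2)),
          ← Finset.sum_range_reflect]
        congr 1
        refine Finset.sum_congr rfl fun i hi => ?_
        have hi := Finset.mem_range.1 hi
        rw [show n - (n + 1 - 1 - i) = i by omega]
    _ ≤ X / d ^ 2 * (2 * n + 12) := by
        refine mul_le_mul_of_nonneg_left ?_ (by positivity)
        rw [sum_half_pow_mul_add_sq]
        exact sub_le_self _ (by positivity)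
    _ = _ := by ring

theorem exists_isFirstCircuit_of_notMem_deviatingFamilies {F : Type*} [Field F] [Fintype F] {n : ℕ}
    {d : ℝ} (w : ℕ → Fin n → F)
    (hw : (fun i : Fin (n + 1) => w i) ∉ deviatingFamilies F n d) :
    ∃ (m : ℕ) (C : Set (Fin m)), IsFirstCircuit w m C ∧
      |(C.ncard : ℝ) - (1 - (Fintype.card F : ℝ)⁻¹) * n| ≤ d := by
  classical
  obtain ⟨j, hj, hI, x, hx⟩ := exists_first_dependency w
  obtain ⟨C, hC, hcard⟩ := exists_isFirstCircuit_of_eq_sum w j hI x hx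
  refine ⟨j + 1, C, hC, ?_⟩
  by_contra! hlt
  refine hw (Finset.mem_filter.2 ⟨Finset.mem_univ _, ⟨j, Nat.lt_succ_iff.2 hj⟩, x, ?_, hx⟩)
  rw [hcard] at hlt
  convert hlt

theorem tendsto_deviation_bound {c : ℝ} (hc : 0 < c) :
    Tendsto (fun n : ℕ => (2 * (n : ℝ) + 12) / (c * n) ^ 2) atTop (𝓝 0) := by
  have h : Tendsto (fun n : ℕ => 2 / c ^ 2 * (n : ℝ)⁻¹ + 12 / c ^ 2 * ((n : ℝ)⁻¹ * (n : ℝ)⁻¹))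
      atTop (𝓝 0) := by
    have h0 := tendsto_inv_atTop_nhds_zero_nat (𝕜 := ℝ)
    simpa using (h0.const_mul (2 / c ^ 2)).add ((h0.mul h0).const_mul (12 / c ^ 2))
  refine h.congr' ?_
  filter_upwards [eventually_gt_atTop 0] with n hn
  have hn : (n : ℝ) ≠ 0 := by exact_mod_cast hn.ne'
  field_simp

theorem tendsto_measure_firstCircuit {F : Type*} [Field F] [Fintype F]
    [MeasurableSpace F] [MeasurableSingletonClass F]
    {Ω : ℕ → Type*} [∀ n, MeasurableSpace (Ω n)]
    (P : ∀ n, Measure (Ω n)) [∀ n, IsProbabilityMeasure (P n)]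
    (v : ∀ n, ℕ → Ω n → (Fin n → F))
    (hlaw : ∀ n i, HasLaw (v n i) (uniformOn Set.univ) (P n))
    (hindep : ∀ n, iIndepFun (v n) (P n)) {ε : ℝ} (hε : 0 < ε) :
    Tendsto (fun n : ℕ => P n {ω | ∃ (m : ℕ) (C : Set (Fin m)),
        IsFirstCircuit (fun i => v n i ω) m C ∧
        |(C.ncard : ℝ) - (1 - (Fintype.card F : ℝ)⁻¹) * n|
          ≤ ε * ((1 - (Fintype.card F : ℝ)⁻¹) * n)})
      atTop (𝓝 1) := by
  have hp : (0 : ℝ) < 1 - (Fintype.card F : ℝ)⁻¹ :=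
    sub_pos.2 (inv_lt_one_of_one_lt₀ (by exact_mod_cast Fintype.one_lt_card (α := F)))
  refine tendsto_measure_one_of_card_le hlaw hindep _ (fun n => n + 1)
    (fun n => deviatingFamilies F n (ε * ((1 - (Fintype.card F : ℝ)⁻¹) * n)))
    (fun n => (2 * n + 12) / (ε * (1 - (Fintype.card F : ℝ)⁻¹) * n) ^ 2)
    (Eventually.of_forall fun n ω hω => exists_isFirstCircuit_of_notMem_deviatingFamilies (fun i => v n i ω) hω) ?_
    (tendsto_deviation_bound (mul_pos hε hp))
  filter_upwards [eventually_gt_atTop 0] with n hn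
  have hn : (0 : ℝ) < n := by exact_mod_cast hn
  rw [mul_assoc ε]
  exact card_deviatingFamilies_le F n (mul_pos hε (mul_pos hp hn))

/-! ### Linear circuits and the exchange of two families -/

/-- The members of `S` form a minimal linearly dependent subfamily of `A`. -/
def IsCircuitOn (F : Type*) {V α : Type*} [Field F] [AddCommGroup V] [Module F V]
    (A : α → V) (S : Set α) : Prop :=
  ¬ LinearIndepOn F A S ∧ ∀ e ∈ S, LinearIndepOn F A (S \ {e})

section CircuitOn

variable {F V α : Type*} [Field F] [AddCommGroup V] [Module F V]

theorem linearIndepOn_congr_of_eqOn {A B : α → V} {S : Set α} (h : Set.EqOn A B S) :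
    LinearIndepOn F A S ↔ LinearIndepOn F B S :=
  ⟨fun hA => hA.congr h, fun hB => hB.congr h.symm⟩

theorem linearIndepOn_linearEquiv_comp (g : V ≃ₗ[F] V) {A : α → V} {S : Set α} :
    LinearIndepOn F (fun i => g (A i)) S ↔ LinearIndepOn F A S :=
  LinearMap.linearIndependent_iff (v := fun i : S => A i) g.toLinearMap g.ker

theorem IsCircuitOn.congr {A B : α → V} {S : Set α} (hA : IsCircuitOn F A S)
    (h : Set.EqOn A B S) : IsCircuitOn F B S :=
  ⟨fun hB => hA.1 ((linearIndepOn_congr_of_eqOn h).2 hB), fun e he =>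
    (linearIndepOn_congr_of_eqOn (h.mono Set.sdiff_subset)).1 (hA.2 e he)⟩

theorem IsCircuitOn.map {A : α → V} {S : Set α} (hA : IsCircuitOn F A S) (g : V ≃ₗ[F] V) :
    IsCircuitOn F (fun i => g (A i)) S :=
  ⟨fun hB => hA.1 ((linearIndepOn_linearEquiv_comp g).1 hB), fun e he =>
    (linearIndepOn_linearEquiv_comp g).2 (hA.2 e he)⟩

theorem isCircuitOn_comp_equiv {β : Type*} (e : β ≃ α) {A : α → V} {S : Set β} :
    IsCircuitOn F (A ∘ e) S ↔ IsCircuitOn F A (e '' S) := by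
  unfold IsCircuitOn
  rw [linearIndepOn_equiv]
  refine and_congr Iff.rfl ?_
  rw [Set.forall_mem_image]
  refine forall₂_congr fun x _ => ?_
  rw [linearIndepOn_equiv, Set.image_sdiff e.injective, Set.image_singleton]

theorem IsCircuitOn.linearIndepOn_of_ssubset {A : α → V} {S U : Set α} (hA : IsCircuitOn F A S)
    (hU : U ⊂ S) : LinearIndepOn F A U := by
  obtain ⟨e, he, heU⟩ := Set.exists_of_ssubset hU
  exact (hA.2 e he).mono fun x hx => ⟨hU.1 hx, fun h => heU (h ▸ hx)⟩

theorem Matrix.columnMatroid_isCircuit_iff {ι : Type*} [Finite α] (A : Matrix ι α F)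
    (S : Set α) : A.columnMatroid.IsCircuit S ↔ IsCircuitOn F A.col S := by
  rw [Matroid.isCircuit_iff_dep_forall_sdiff_singleton_indep, Matroid.Dep,
    A.columnMatroid_ground,
    and_iff_left (Set.subset_univ S)]
  rfl

/-- The general linear group acts transitively on the independent families indexed by a type. -/
theorem exists_linearEquiv_apply_eq [FiniteDimensional F V] {ι : Type*} {a b : ι → V}
    (ha : LinearIndependent F a) (hb : LinearIndependent F b) :
    ∃ g : V ≃ₗ[F] V, ∀ i, g (b i) = a i := by
  obtain ⟨g, hg⟩ := Submodule.exists_linearEquiv_restrict_eq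
    (hb.linearCombinationEquiv.symm ≪≫ₗ ha.linearCombinationEquiv)
  refine ⟨g, fun i => ?_⟩
  have h1 : hb.linearCombinationEquiv (Finsupp.single i 1)
      = ⟨b i, Submodule.subset_span ⟨i, rfl⟩⟩ := by
    ext; simp
  have h2 := hg ⟨b i, Submodule.subset_span ⟨i, rfl⟩⟩
  rw [LinearEquiv.trans_apply, ← h1, LinearEquiv.symm_apply_apply] at h2
  rw [h1] at h2
  rw [← h2]
  simp

open Classical in
/-- A linear automorphism that takes the first independent family to the second one. -/
noncomputable def aligningEquiv [FiniteDimensional F V] {ι : Type*} (a b : ι → V) : V ≃ₗ[F] V :=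
  if h : LinearIndependent F a ∧ LinearIndependent F b then
    (exists_linearEquiv_apply_eq h.1 h.2).choose
  else LinearEquiv.refl F V

theorem aligningEquiv_apply [FiniteDimensional F V] {ι : Type*} {a b : ι → V}
    (ha : LinearIndependent F a) (hb : LinearIndependent F b) (i : ι) :
    aligningEquiv (F := F) a b (b i) = a i := by
  rw [aligningEquiv, dif_pos ⟨ha, hb⟩]
  exact (exists_linearEquiv_apply_eq ha hb).choose_spec i

open Classical in
/-- Exchange the members of two families indexed by `T \ S`, after aligning the families
on `S ∩ T`. -/
noncomputable def alignedSwap (F : Type*) {V α : Type*} [Field F] [AddCommGroup V] [Module F V]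
    [FiniteDimensional F V] (S T : Set α) (p : (α → V) × (α → V)) : (α → V) × (α → V) :=
  let g : V ≃ₗ[F] V := aligningEquiv (fun i : ↥(S ∩ T) => p.1 i) (fun i : ↥(S ∩ T) => p.2 i)
  ((T \ S).piecewise (fun i => g (p.2 i)) p.1, (T \ S).piecewise (fun i => g.symm (p.1 i)) p.2)

/-- The aligning map is determined by the restrictions to `S ∩ T`, which the swap leaves untouched,
so the second swap uses the same map and undoes the first. As the map defaults to the identity on
dependent data, this holds for all pairs. -/
theorem alignedSwap_alignedSwap [FiniteDimensional F V] (S T : Set α) (p : (α → V) × (α → V)) :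
    alignedSwap F S T (alignedSwap F S T p) = p := by
  classical
  have h1 : (fun i : ↥(S ∩ T) => (alignedSwap F S T p).1 i) = fun i : ↥(S ∩ T) => p.1 i := by
    ext ⟨i, hi⟩
    simp [alignedSwap, hi.1]
  have h2 : (fun i : ↥(S ∩ T) => (alignedSwap F S T p).2 i) = fun i : ↥(S ∩ T) => p.2 i := by
    ext ⟨i, hi⟩
    simp [alignedSwap, hi.1]
  rw [alignedSwap, h1, h2]
  ext i
  · by_cases hi : i ∈ T \ S <;> simp [alignedSwap, hi]
  · by_cases hi : i ∈ T \ S <;> simp [alignedSwap, hi]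

/-- Given that the common members are independent, the events that two sets are circuits are
independent. -/
theorem card_isCircuitOn_inter_mul [Fintype V] [Fintype α] [FiniteDimensional F V]
    [DecidableEq α] {S T : Set α} (hST : ¬ S ⊆ T) (hTS : ¬ T ⊆ S)
    [DecidablePred fun A : α → V => IsCircuitOn F A S]
    [DecidablePred fun A : α → V => IsCircuitOn F A T]
    [DecidablePred fun A : α → V => IsCircuitOn F A S ∧ IsCircuitOn F A T]
    [DecidablePred fun A : α → V => LinearIndepOn F A (S ∩ T)] :
    (Finset.univ.filter fun A : α → V => IsCircuitOn F A S ∧ IsCircuitOn F A T).card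
        * (Finset.univ.filter fun A : α → V => LinearIndepOn F A (S ∩ T)).card
      = (Finset.univ.filter fun A : α → V => IsCircuitOn F A S).card
        * (Finset.univ.filter fun A : α → V => IsCircuitOn F A T).card := by
  classical
  rw [← Finset.card_product, ← Finset.card_product]
  have hS : S ∩ T ⊂ S := ⟨Set.inter_subset_left, fun h => hST fun x hx => (h hx).2⟩
  have hT : S ∩ T ⊂ T := ⟨Set.inter_subset_right, fun h => hTS fun x hx => (h hx).1⟩
  have hfst : ∀ p : (α → V) × (α → V), Set.EqOn p.1 (alignedSwap F S T p).1 S := by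
    intro p i hi
    simp [alignedSwap, hi]
  have hsnd : ∀ p : (α → V) × (α → V), Set.EqOn p.2 (alignedSwap F S T p).2 (S ∩ T) := by
    intro p i hi
    simp [alignedSwap, hi.1]
  -- When both families are independent on `S ∩ T`, the swap replaces each on all of `T` by a linear
  -- image of the other: alignment covers `S ∩ T`, exchange covers `T \ S`. Circuits on `T` thus
  -- change sides, while the first family is fixed on `S`.
  have halign : ∀ p : (α → V) × (α → V), LinearIndepOn F p.1 (S ∩ T) →
      LinearIndepOn F p.2 (S ∩ T) → ∃ g : V ≃ₗ[F] V,
      Set.EqOn (fun i => g (p.2 i)) (alignedSwap F S T p).1 T ∧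
      Set.EqOn (fun i => g.symm (p.1 i)) (alignedSwap F S T p).2 T := by
    intro p h1 h2
    refine ⟨aligningEquiv (fun i : ↥(S ∩ T) => p.1 i) (fun i : ↥(S ∩ T) => p.2 i), fun i hi => ?_,
      fun i hi => ?_⟩
    · by_cases hiS : i ∈ S
      · have := aligningEquiv_apply h1 h2 ⟨i, hiS, hi⟩
        simpa [alignedSwap, hiS] using this
      · simp [alignedSwap, hi, hiS]
    · by_cases hiS : i ∈ S
      · have := aligningEquiv_apply h1 h2 ⟨i, hiS, hi⟩
        simp only [alignedSwap, Set.mem_sdiff, hi, hiS, not_true_eq_false, and_false,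
          not_false_eq_true, Set.piecewise_eq_of_notMem]
        rw [LinearEquiv.symm_apply_eq]
        exact this.symm
      · simp [alignedSwap, hi, hiS]
  refine Finset.card_nbij' (alignedSwap F S T) (alignedSwap F S T) ?_ ?_
    (fun p _ => alignedSwap_alignedSwap S T p) (fun p _ => alignedSwap_alignedSwap S T p)
  · intro p hp
    simp only [Finset.coe_product, Set.mem_prod, Finset.mem_coe, Finset.mem_filter,
      Finset.mem_univ, true_and] at hp ⊢
    obtain ⟨g, -, hg⟩ := halign p (hp.1.1.linearIndepOn_of_ssubset hS) hp.2
    exact ⟨hp.1.1.congr (hfst p), (hp.1.2.map g.symm).congr hg⟩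
  · intro p hp
    simp only [Finset.coe_product, Set.mem_prod, Finset.mem_coe, Finset.mem_filter,
      Finset.mem_univ, true_and] at hp ⊢
    have h2 := hp.2.linearIndepOn_of_ssubset hT
    obtain ⟨g, hg, -⟩ := halign p (hp.1.linearIndepOn_of_ssubset hS) h2
    exact ⟨⟨hp.1.congr (hfst p), (hp.2.map g).congr hg⟩,
      (linearIndepOn_congr_of_eqOn (hsnd p)).1 h2⟩

end CircuitOn

/-! ### Counting independent families and circuits -/

section Counting

variable {F V α : Type*} [Field F] [AddCommGroup V] [Module F V]

/-- All but a proportion `q ^ |U| / |V|` of the families are independent on `U`. -/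
theorem card_sub_le_card_linearIndepOn [Fintype F] [Fintype V] [Fintype α] [DecidableEq α]
    (U : Finset α) [DecidablePred fun A : α → V => LinearIndepOn F A (U : Set α)] :
    (Fintype.card (α → V) : ℝ) * (1 - (Fintype.card F : ℝ) ^ U.card / Fintype.card V)
      ≤ (Finset.univ.filter fun A : α → V => LinearIndepOn F A (U : Set α)).card := by
  classical
  have hV : (0 : ℝ) < Fintype.card V := by exact_mod_cast Fintype.card_pos
  -- Relations on `U` are extended by zero; the union bound then runs over the fewer than `q ^ |U|`
  -- nonzero ones.
  let ext0 : (U → F) → α → F := fun x i => if h : i ∈ U then x ⟨i, h⟩ else 0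
  have hsub : (Finset.univ : Finset (α → V)) ⊆
      (Finset.univ.filter fun A : α → V => LinearIndepOn F A (U : Set α)) ∪
      (Finset.univ.erase (0 : U → F)).biUnion fun x =>
        Finset.univ.filter fun A : α → V => ∑ i, ext0 x i • A i = 0 := by
    intro A _
    by_cases hA : LinearIndepOn F A (U : Set α)
    · exact Finset.mem_union_left _ (Finset.mem_filter.2 ⟨Finset.mem_univ _, hA⟩)
    · refine Finset.mem_union_right _ ?_
      have hA' : ¬ LinearIndependent F fun i : U => A i := hA
      rw [Fintype.not_linearIndependent_iff] at hA'
      obtain ⟨x, hx, i, hi⟩ := hA'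
      refine Finset.mem_biUnion.2 ⟨x, Finset.mem_erase.2 ⟨fun h => hi (by simp [h]),
        Finset.mem_univ _⟩, Finset.mem_filter.2 ⟨Finset.mem_univ _, ?_⟩⟩
      rw [← hx, ← Finset.sum_subset (Finset.subset_univ U) (fun i _ hi => by simp [ext0, hi]),
        ← Finset.sum_coe_sort U]
      exact Finset.sum_congr rfl fun i _ => by simp [ext0]
  have hrel : ∀ x ∈ Finset.univ.erase (0 : U → F),
      ((Finset.univ.filter fun A : α → V => ∑ i, ext0 x i • A i = 0).card : ℝ)
        = Fintype.card (α → V) / Fintype.card V := by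
    intro x hx
    rw [eq_div_iff hV.ne']
    have hx0 : ext0 x ≠ 0 := fun h => Finset.ne_of_mem_erase hx <| by
      ext i
      simpa [ext0] using congrFun h i
    exact_mod_cast card_filter_sum_smul_eq_zero_mul (V := V) (ext0 x) hx0
  have h1 := (Finset.card_le_card hsub).trans
    ((Finset.card_union_le _ _).trans (Nat.add_le_add_left Finset.card_biUnion_le _))
  have h2 : (Fintype.card (α → V) : ℝ)
      ≤ (Finset.univ.filter fun A : α → V => LinearIndepOn F A (U : Set α)).card
        + ∑ x ∈ Finset.univ.erase (0 : U → F),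
          ((Finset.univ.filter fun A : α → V => ∑ i, ext0 x i • A i = 0).card : ℝ) := by
    rw [Finset.card_univ] at h1
    exact_mod_cast h1
  rw [Finset.sum_congr rfl hrel, Finset.sum_const, nsmul_eq_mul] at h2
  have h3 : ((Finset.univ.erase (0 : U → F)).card : ℝ) ≤ (Fintype.card F : ℝ) ^ U.card := by
    have : (Finset.univ.erase (0 : U → F)).card ≤ Fintype.card F ^ U.card := by
      refine (Finset.card_le_univ _).trans ?_
      simp
    exact_mod_cast this
  have h4 : ((Finset.univ.erase (0 : U → F)).card : ℝ)
      * (Fintype.card (α → V) / Fintype.card V)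
      ≤ (Fintype.card F : ℝ) ^ U.card * (Fintype.card (α → V) / Fintype.card V) :=
    mul_le_mul_of_nonneg_right h3 (by positivity)
  have h5 : (Fintype.card (α → V) : ℝ) * (1 - (Fintype.card F : ℝ) ^ U.card / Fintype.card V)
      = Fintype.card (α → V)
        - (Fintype.card F : ℝ) ^ U.card * (Fintype.card (α → V) / Fintype.card V) := by ring
  linarith

/-- A linear combination with nonzero coefficients closes an independent family into a circuit. -/
theorem isCircuitOn_update [DecidableEq α] {A : α → V} {U : Finset α} {l : α} (hl : l ∉ U)
    (hA : LinearIndepOn F A (U : Set α)) (c : U → Fˣ) :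
    IsCircuitOn F (Function.update A l (∑ i, (c i : F) • A i)) ((insert l U : Finset α) : Set α) := by
  set B := Function.update A l (∑ i, (c i : F) • A i) with hB
  have hBl : B l = ∑ i, (c i : F) • A i := by simp [hB]
  have hBU : Set.EqOn A B (U : Set α) := fun i hi => by
    have : i ≠ l := fun h => hl (h ▸ hi)
    simp [hB, this]
  have hlU : l ∉ (U : Set α) := by simpa using hl
  have hBI : LinearIndepOn F B (U : Set α) := (linearIndepOn_congr_of_eqOn hBU).1 hA
  rw [Finset.coe_insert]
  refine ⟨?_, ?_⟩
  · rw [linearIndepOn_insert hlU, hBl]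
    exact fun h => h.2 (Submodule.sum_mem _ fun i _ => Submodule.smul_mem _ _
      (Submodule.subset_span ⟨i, i.2, (hBU i.2).symm⟩))
  · intro e he
    by_cases hel : e = l
    · subst hel
      rw [Set.insert_sdiff_of_mem _ (Set.mem_singleton _)]
      exact hBI.mono Set.sdiff_subset
    · have heU : e ∈ U := by simpa [hel] using he
      rw [Set.insert_sdiff_of_notMem _ (by simpa using Ne.symm hel),
        linearIndepOn_insert (fun h => hlU h.1), hBl]
      refine ⟨hBI.mono Set.sdiff_subset, ?_⟩
      have him : B '' ((U : Set α) \ {e}) = (fun i : U => A i) '' {k | k ≠ ⟨e, heU⟩} := by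
        ext y
        constructor
        · rintro ⟨k, ⟨hk, hke⟩, rfl⟩
          exact ⟨⟨k, hk⟩, fun h => hke (congrArg Subtype.val h), hBU hk⟩
        · rintro ⟨k, hk, rfl⟩
          exact ⟨k, ⟨k.2, fun h => hk (Subtype.ext h)⟩, (hBU k.2).symm⟩
      rw [him]
      exact (notMem_span_image_ne_iff (u := fun i : U => A i) hA (fun i => (c i : F)) ⟨e, heU⟩).2
        (c _).ne_zero

/-- Overwrite the member at `l` by a combination with nonzero coefficients and remember the old
member. Nothing is lost: independence on `U` lets the coefficients be read off from the new member.
-/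
theorem card_linearIndepOn_mul_le [Fintype F] [Fintype V] [Fintype α] [DecidableEq α]
    {U : Finset α} {l : α} (hl : l ∉ U)
    [DecidablePred fun A : α → V => LinearIndepOn F A (U : Set α)]
    [DecidablePred fun A : α → V => IsCircuitOn F A ((insert l U : Finset α) : Set α)] :
    (Finset.univ.filter fun A : α → V => LinearIndepOn F A (U : Set α)).card
        * (Fintype.card F - 1) ^ U.card
      ≤ (Finset.univ.filter fun A : α → V =>
          IsCircuitOn F A ((insert l U : Finset α) : Set α)).card * Fintype.card V := by
  classical
  have hcard : (Fintype.card F - 1) ^ U.card = (Finset.univ : Finset (U → Fˣ)).card := by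
    simp [Fintype.card_units]
  rw [hcard, ← Finset.card_product, ← Finset.card_univ (α := V), ← Finset.card_product]
  refine Finset.card_le_card_of_injOn
    (fun p => (Function.update p.1 l (∑ i, (p.2 i : F) • p.1 i), p.1 l)) ?_ ?_
  · intro p hp
    simp only [Finset.coe_product, Set.mem_prod, Finset.mem_coe, Finset.mem_filter,
      Finset.mem_univ, true_and, and_true] at hp ⊢
    exact isCircuitOn_update hl hp p.2
  · rintro ⟨A, c⟩ hA ⟨B, d⟩ hB h
    simp only [Finset.coe_product, Set.mem_prod, Finset.mem_coe, Finset.mem_filter,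
      Finset.mem_univ, true_and, and_true, Prod.mk.injEq] at hA hB h
    obtain ⟨h1, h2⟩ := h
    have hAB : A = B := by
      ext i
      by_cases hi : i = l
      · rw [hi, h2]
      · simpa [hi] using congrFun h1 i
    subst hAB
    have h3 : ∑ i, (c i : F) • A i = ∑ i, (d i : F) • A i := by
      simpa using congrFun h1 l
    have h4 : ∀ i : U, (c i : F) = d i := by
      have hind : LinearIndependent F (fun i : U => A i) := hA
      rw [Fintype.linearIndependent_iff] at hind
      intro i
      rw [← sub_eq_zero]
      refine hind (fun i => (c i : F) - d i) ?_ i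
      simp only [sub_smul, Finset.sum_sub_distrib, h3, sub_self]
    have h5 : c = d := funext fun i => Units.ext (h4 i)
    rw [h5]

/-- The number of families in which a given set is a circuit depends only on the size of the set. -/
theorem card_isCircuitOn_eq [Fintype V] [Fintype α] [DecidableEq α] {S T : Finset α}
    (h : S.card = T.card)
    [DecidablePred fun A : α → V => IsCircuitOn F A (S : Set α)]
    [DecidablePred fun A : α → V => IsCircuitOn F A (T : Set α)] :
    (Finset.univ.filter fun A : α → V => IsCircuitOn F A (S : Set α)).card
      = (Finset.univ.filter fun A : α → V => IsCircuitOn F A (T : Set α)).card := by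
  classical
  -- A bijection from `S` to `T` extends to a permutation of all indices; relabelling by it matches
  -- the two counts.
  let e : {x // x ∈ S} ≃ {x // x ∈ T} := Fintype.equivOfCardEq (by simpa using h)
  let σ : Equiv.Perm α := e.extendSubtype
  have hσ : σ '' (S : Set α) = T := by
    refine Set.eq_of_subset_of_ncard_le ?_ ?_ (Set.toFinite _)
    · rintro _ ⟨x, hx, rfl⟩
      exact e.extendSubtype_mem x hx
    · rw [Set.ncard_image_of_injective _ σ.injective, Set.ncard_coe_finset, Set.ncard_coe_finset, h]
  refine Finset.card_equiv (σ.arrowCongr (Equiv.refl V)) fun A => ?_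
  have hA : A = (σ.arrowCongr (Equiv.refl V) A) ∘ σ := by
    ext i; simp [Equiv.arrowCongr]
  simp only [Finset.mem_filter, Finset.mem_univ, true_and]
  conv_lhs => rw [hA]
  rw [isCircuitOn_comp_equiv, hσ]

end Counting

/-! ### Second moment method and binomial estimates -/

/-- The second moment method for the number of occurrences among equally likely events. -/
theorem card_forall_notMem_mul_sq_le {X ι : Type*} [Fintype X] [DecidableEq X] (s : Finset ι)
    (C : ι → Finset X) {c : ℝ} (hc : ∀ i ∈ s, ((C i).card : ℝ) = c)
    (B : Finset X) (hB : ∀ A ∈ B, ∀ i ∈ s, A ∉ C i) :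
    (B.card : ℝ) * (s.card * c) ^ 2
      ≤ (Fintype.card X : ℝ) * (Fintype.card X * ∑ i ∈ s, ∑ j ∈ s, ((C i ∩ C j).card : ℝ)
        - (s.card * c) ^ 2) := by
  set N : ℝ := (Fintype.card X : ℝ) with hN
  let Z : X → ℝ := fun A => ∑ i ∈ s, if A ∈ C i then 1 else 0
  have h1 : ∑ A, Z A = s.card * c := by
    rw [Finset.sum_comm, Finset.sum_congr rfl (fun i hi => ?_), Finset.sum_const, nsmul_eq_mul]
    rw [Finset.sum_boole, Finset.filter_univ_mem, hc i hi]
  have h2 : ∑ A, Z A ^ 2 = ∑ i ∈ s, ∑ j ∈ s, ((C i ∩ C j).card : ℝ) := by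
    have : ∀ A, Z A ^ 2 = ∑ i ∈ s, ∑ j ∈ s, if A ∈ C i ∩ C j then (1 : ℝ) else 0 := by
      intro A
      rw [pow_two, Finset.sum_mul_sum]
      refine Finset.sum_congr rfl fun i _ => Finset.sum_congr rfl fun j _ => ?_
      by_cases hi : A ∈ C i <;> by_cases hj : A ∈ C j <;> simp [hi, hj]
    rw [Finset.sum_congr rfl fun A _ => this A, Finset.sum_comm]
    refine Finset.sum_congr rfl fun i _ => ?_
    rw [Finset.sum_comm]
    refine Finset.sum_congr rfl fun j _ => ?_
    rw [Finset.sum_boole, Finset.filter_univ_mem]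
  -- The mean of `Z` is `s.card * c / N`; scaling by `N` avoids division. On `B` the count `Z`
  -- vanishes, so every term there equals `(s.card * c) ^ 2`.
  calc _ = ∑ A ∈ B, (N * Z A - s.card * c) ^ 2 := by
        rw [← nsmul_eq_mul, ← Finset.sum_const]
        refine Finset.sum_congr rfl fun A hA => ?_
        have hZ : Z A = 0 := Finset.sum_eq_zero fun i hi => if_neg (hB A hA i hi)
        rw [hZ]; ring
    _ ≤ ∑ A, (N * Z A - s.card * c) ^ 2 :=
        Finset.sum_le_sum_of_subset_of_nonneg (Finset.subset_univ _) fun _ _ _ => sq_nonneg _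
    _ = N ^ 2 * ∑ A, Z A ^ 2 - 2 * N * (s.card * c) * ∑ A, Z A + N * (s.card * c) ^ 2 := by
        rw [Finset.mul_sum, Finset.mul_sum, ← Finset.sum_sub_distrib, hN, ← nsmul_eq_mul (Fintype.card X),
          ← Finset.card_univ, ← Finset.sum_const, ← Finset.sum_add_distrib]
        exact Finset.sum_congr rfl fun A _ => by ring
    _ = _ := by rw [h1, h2]; ring

/-- The generating function of the number of elements of a set that a random subset misses. -/
theorem sum_half_pow_card_sdiff {α : Type*} [Fintype α] [DecidableEq α] (S : Finset α) :
    ∑ T : Finset α, (1 / 2 : ℝ) ^ (S \ T).card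
      = (3 / 2) ^ S.card * 2 ^ (Fintype.card α - S.card) := by
  -- Expanding the product over subsets `T` gives weight `1 / 2` to each missed element of `S`; the
  -- factors are `3 / 2` on `S` and `2` off it.
  have h := Fintype.prod_add (fun _ : α => (1 : ℝ)) (fun i => if i ∈ S then (1 / 2 : ℝ) else 1)
  have h1 : ∀ T : Finset α, (∏ _i ∈ T, (1 : ℝ)) * ∏ i ∈ Tᶜ, (if i ∈ S then (1 / 2 : ℝ) else 1)
      = (1 / 2 : ℝ) ^ (S \ T).card := by
    intro T
    rw [Finset.prod_const_one, one_mul, Finset.prod_ite, Finset.prod_const, Finset.prod_const_one,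
      mul_one]
    congr 2
    ext i; simp [and_comm]
  rw [Finset.sum_congr rfl fun T _ => h1 T] at h
  rw [← h]
  have h2 : ∀ i, (1 : ℝ) + (if i ∈ S then (1 / 2 : ℝ) else 1) = if i ∈ S then 3 / 2 else 2 := by
    intro i; split_ifs <;> norm_num
  rw [Finset.prod_congr rfl fun i _ => h2 i, Finset.prod_ite, Finset.prod_const, Finset.prod_const,
    Finset.filter_univ_mem, ← Finset.compl_filter, Finset.filter_univ_mem, Finset.card_compl]

theorem four_pow_le_four_mul_choose {n : ℕ} (hn : 0 < n) :
    (4 : ℝ) ^ n ≤ (2 * n - 1).choose n * (4 * n) := by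
  have h1 := Nat.four_pow_le_two_mul_self_mul_centralBinom n hn
  have h2 : Nat.centralBinom n = 2 * (2 * n - 1).choose n := by
    obtain ⟨k, rfl⟩ := Nat.exists_eq_succ_of_ne_zero hn.ne'
    rw [Nat.centralBinom, show 2 * k.succ = (2 * k + 1) + 1 by omega, Nat.succ_eq_add_one,
      Nat.choose_succ_succ, Nat.choose_symm_half, Nat.add_sub_cancel, Nat.choose_symm_half]
    ring
  rw [h2] at h1
  calc (4 : ℝ) ^ n ≤ ((2 * n * (2 * (2 * n - 1).choose n) : ℕ) : ℝ) := by exact_mod_cast h1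
    _ = _ := by push_cast; ring

/-! ### Circuits of length `n` among `2 n - 1` vectors -/

section HamiltonCount

variable {F α : Type*} [Field F] [Fintype F] [Fintype α] [DecidableEq α] {n : ℕ}

/-- The failure fraction `q ^ |U| / q ^ n = q ^ (-j)` is at most `2 ^ (-j)`, a bound uniform in the
field. -/
theorem card_mul_one_sub_half_pow_le (U : Finset α) {j : ℕ} (hj : U.card + j = n)
    [DecidablePred fun A : α → Fin n → F => LinearIndepOn F A (U : Set α)] :
    (Fintype.card (α → Fin n → F) : ℝ) * (1 - (1 / 2) ^ j)
      ≤ (Finset.univ.filter fun A : α → Fin n → F => LinearIndepOn F A (U : Set α)).card := by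
  classical
  have hq2 : (2 : ℝ) ≤ Fintype.card F := by exact_mod_cast Fintype.one_lt_card (α := F)
  have hq0 : (0 : ℝ) < Fintype.card F := by linarith
  refine le_trans ?_ (card_sub_le_card_linearIndepOn U)
  refine mul_le_mul_of_nonneg_left (sub_le_sub_left ?_ _) (Nat.cast_nonneg _)
  have hV : (Fintype.card (Fin n → F) : ℝ) = (Fintype.card F : ℝ) ^ (U.card + j) := by
    rw [hj]; simp
  rw [hV, pow_add, div_mul_eq_div_div, div_self (by positivity), ← one_div_pow]
  gcongr

/-- A set of `n` vectors in dimension `n` is a circuit with probability at least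
`1 / (q * 2 ^ n)`. -/
theorem card_le_card_isCircuitOn_mul (hn : 0 < n) {S : Finset α} (hS : S.card = n)
    [DecidablePred fun A : α → Fin n → F => IsCircuitOn F A (S : Set α)] :
    (Fintype.card (α → Fin n → F) : ℝ)
      ≤ (Finset.univ.filter fun A : α → Fin n → F => IsCircuitOn F A (S : Set α)).card
        * (Fintype.card F * 2 ^ n) := by
  classical
  obtain ⟨l, hl⟩ := Finset.card_pos.1 (hS ▸ hn)
  obtain ⟨U, hlU, rfl⟩ : ∃ U : Finset α, l ∉ U ∧ insert l U = S :=
    ⟨S.erase l, Finset.notMem_erase l S, Finset.insert_erase hl⟩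
  rw [Finset.card_insert_of_notMem hlU] at hS
  subst hS
  set q : ℝ := (Fintype.card F : ℝ) with hq
  have hq2 : (2 : ℝ) ≤ q := by
    rw [hq]
    exact_mod_cast Fintype.one_lt_card (α := F)
  have hq0 : 0 < q := by linarith
  have h1 := card_mul_one_sub_half_pow_le (F := F) (n := U.card + 1) U (j := 1) rfl
  have h2 : ((Finset.univ.filter fun A : α → Fin (U.card + 1) → F =>
        LinearIndepOn F A (U : Set α)).card : ℝ) * (q - 1) ^ U.card
      ≤ (Finset.univ.filter fun A : α → Fin (U.card + 1) → F =>
          IsCircuitOn F A ((insert l U : Finset α) : Set α)).card * q ^ (U.card + 1) := by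
    have h := card_linearIndepOn_mul_le (F := F) (V := Fin (U.card + 1) → F) hlU
    rw [Fintype.card_fun, Fintype.card_fin] at h
    have h' : ((Fintype.card F - 1 : ℕ) : ℝ) = q - 1 := by
      rw [Nat.cast_sub Fintype.card_pos, Nat.cast_one]
    rw [← h', hq]
    exact_mod_cast h
  -- For `q ≥ 2`, `q - 1 ≥ q / 2`; this is the source of the `2 ^ n` in the bound.
  have h3 : (q / 2) ^ U.card ≤ (q - 1) ^ U.card := pow_le_pow_left₀ (by positivity) (by linarith) U.card
  have h4 : (Fintype.card (α → Fin (U.card + 1) → F) : ℝ) * (1 / 2) * (q / 2) ^ U.card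
      ≤ (Finset.univ.filter fun A : α → Fin (U.card + 1) → F =>
          IsCircuitOn F A ((insert l U : Finset α) : Set α)).card * q ^ (U.card + 1) := by
    refine le_trans (mul_le_mul ?_ h3 (by positivity) (Nat.cast_nonneg _)) h2
    refine le_trans (le_of_eq ?_) h1
    norm_num
  rw [div_pow] at h4
  have h5 : (0 : ℝ) < q ^ U.card / 2 ^ (U.card + 1) := by positivity
  refine le_of_mul_le_mul_right (le_trans (le_of_eq ?_) (h4.trans (le_of_eq ?_))) h5
  · field_simp
    ring
  · field_simp
    ring

/-- By conditional independence the correlation factor is the inverse of the probability that `S ∩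
T` is independent, hence at most `1 / (1 - x)` with `x = 2 ^ (-|S \ T|)`. As `S ≠ T` have equal
size, `x ≤ 1 / 2`, and so `1 / (1 - x) ≤ 1 + 2 * x`. -/
theorem card_mul_card_isCircuitOn_inter_le {S T : Finset α} (hS : S.card = n) (hT : T.card = n)
    (hST : S ≠ T) [∀ S : Finset α, DecidablePred fun A : α → Fin n → F =>
      IsCircuitOn F A (S : Set α)] :
    (Fintype.card (α → Fin n → F) : ℝ) *
        (Finset.univ.filter fun A : α → Fin n → F =>
          IsCircuitOn F A (S : Set α) ∧ IsCircuitOn F A (T : Set α)).card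
      ≤ ((Finset.univ.filter fun A : α → Fin n → F => IsCircuitOn F A (S : Set α)).card : ℝ) ^ 2
        * (1 + 2 * (1 / 2) ^ (S \ T).card) := by
  classical
  have hnST : ¬ S ⊆ T := fun h => hST (Finset.eq_of_subset_of_card_le h (by omega))
  have hnTS : ¬ T ⊆ S := fun h => hST (Finset.eq_of_subset_of_card_le h (by omega)).symm
  have h1 := card_isCircuitOn_inter_mul (F := F) (V := Fin n → F) (S := (S : Set α))
    (T := (T : Set α)) (by exact_mod_cast hnST) (by exact_mod_cast hnTS)
  rw [card_isCircuitOn_eq (F := F) (V := Fin n → F) (hT.trans hS.symm), ← pow_two] at h1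
  have h2 := card_mul_one_sub_half_pow_le (F := F) (n := n) (S ∩ T) (j := (S \ T).card)
    (by rw [Finset.card_inter_add_card_sdiff, hS])
  have hj : 1 ≤ (S \ T).card := Finset.card_pos.2 (Finset.sdiff_nonempty.2 hnST)
  have hx0 : (0 : ℝ) ≤ (1 / 2) ^ (S \ T).card := by positivity
  have hx1 : ((1 : ℝ) / 2) ^ (S \ T).card ≤ 1 / 2 := by
    simpa using pow_le_pow_of_le_one (by norm_num : (0 : ℝ) ≤ 1 / 2) (by norm_num) hj
  simp only [Finset.coe_inter] at h2
  rify at h1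
  rw [← h1]
  set x : ℝ := (1 / 2) ^ (S \ T).card
  set N : ℝ := (Fintype.card (α → Fin n → F) : ℝ) with hN
  have hN0 : 0 ≤ N := Nat.cast_nonneg _
  have hx2 : 1 ≤ (1 - x) * (1 + 2 * x) := by nlinarith
  have h3 : N ≤ (Finset.univ.filter fun A : α → Fin n → F =>
      LinearIndepOn F A ((S : Set α) ∩ T)).card * (1 + 2 * x) := by
    refine le_trans ?_ (mul_le_mul_of_nonneg_right h2 (by positivity))
    rw [mul_assoc]
    exact le_mul_of_one_le_right hN0 hx2
  calc _ = ((Finset.univ.filter fun A : α → Fin n → F =>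
        IsCircuitOn F A (S : Set α) ∧ IsCircuitOn F A (T : Set α)).card : ℝ) * N := mul_comm _ _
    _ ≤ _ := by
      rw [mul_assoc]
      exact mul_le_mul_of_nonneg_left h3 (Nat.cast_nonneg _)

end HamiltonCount

/-- The families of `2 * n - 1` vectors without a circuit of length `n`. -/
noncomputable def hamiltonFreeFamilies (F : Type*) [Field F] [Fintype F] (n : ℕ) :
    Finset (Fin (2 * n - 1) → Fin n → F) :=
  open Classical in
  Finset.univ.filter fun A => ∀ S ∈ Finset.powersetCard n (Finset.univ : Finset (Fin (2 * n - 1))),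
    ¬ IsCircuitOn F A (S : Set (Fin (2 * n - 1)))

theorem card_hamiltonFreeFamilies_le (F : Type*) [Field F] [Fintype F] {n : ℕ} (hn : 0 < n) :
    ((hamiltonFreeFamilies F n).card : ℝ)
      ≤ (Fintype.card F + 2) * (4 * n) * (3 / 4) ^ n
        * Fintype.card (Fin (2 * n - 1) → Fin n → F) := by
  classical
  set N : ℝ := (Fintype.card (Fin (2 * n - 1) → Fin n → F) : ℝ) with hN
  have hN0 : 0 < N := by
    rw [hN]
    exact_mod_cast Fintype.card_pos
  set s := Finset.powersetCard n (Finset.univ : Finset (Fin (2 * n - 1))) with hs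
  have hmem : ∀ S, S ∈ s ↔ S.card = n := fun S => by simp [hs]
  have hM : s.card = (2 * n - 1).choose n := by simp [hs, Finset.card_powersetCard]
  let C : Finset (Fin (2 * n - 1)) → Finset (Fin (2 * n - 1) → Fin n → F) :=
    fun S => Finset.univ.filter fun A => IsCircuitOn F A (S : Set (Fin (2 * n - 1)))
  have hM0 : 0 < s.card := by
    rw [hM]
    exact Nat.choose_pos (by omega)
  obtain ⟨S₀, hS₀⟩ := Finset.card_pos.1 hM0
  set c : ℝ := ((C S₀).card : ℝ) with hc
  have hCc : ∀ S ∈ s, ((C S).card : ℝ) = c := fun S hS => by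
    rw [hc]
    exact_mod_cast card_isCircuitOn_eq (((hmem S).1 hS).trans ((hmem S₀).1 hS₀).symm)
  have hNc : N ≤ c * (Fintype.card F * 2 ^ n) :=
    card_le_card_isCircuitOn_mul hn ((hmem S₀).1 hS₀)
  have hc0 : 0 < c := pos_of_mul_pos_left (hN0.trans_le hNc) (by positivity)
  have hMR : (0 : ℝ) < s.card := by exact_mod_cast hM0
  have hpair : ∀ S ∈ s, ∀ T ∈ s, N * ((C S ∩ C T).card : ℝ)
      ≤ (if S = T then N * c else 0) + (c ^ 2 + 2 * c ^ 2 * (1 / 2) ^ (S \ T).card) := by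
    intro S hS T hT
    split_ifs with hST
    · subst hST
      rw [Finset.inter_self, hCc S hS]
      exact le_add_of_nonneg_right (by positivity)
    · have h := card_mul_card_isCircuitOn_inter_le (F := F) ((hmem S).1 hS) ((hmem T).1 hT) hST
      rw [zero_add, ← Finset.filter_and]
      refine h.trans (le_of_eq ?_)
      have := hCc S hS
      simp only [C] at this
      rw [this]
      ring
  have hmiss : ∀ S ∈ s, ∑ T ∈ s, (1 / 2 : ℝ) ^ (S \ T).card ≤ 3 ^ n := by
    intro S hS
    refine (Finset.sum_le_sum_of_subset_of_nonneg (Finset.subset_univ s)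
      fun _ _ _ => by positivity).trans ?_
    -- The full sum over subsets is `(3 / 2) ^ n * 2 ^ (n - 1)`, below `3 ^ n`.
    rw [sum_half_pow_card_sdiff, (hmem S).1 hS, Fintype.card_fin,
      show (3 : ℝ) = 3 / 2 * 2 by norm_num, mul_pow, show (3 : ℝ) / 2 * 2 / 2 = 3 / 2 by norm_num]
    exact mul_le_mul_of_nonneg_left (pow_le_pow_right₀ (by norm_num) (by omega)) (by positivity)
  have hW : N * ∑ S ∈ s, ∑ T ∈ s, ((C S ∩ C T).card : ℝ)
      ≤ s.card * (N * c + (s.card * c ^ 2 + 2 * c ^ 2 * 3 ^ n)) := by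
    rw [Finset.mul_sum, ← nsmul_eq_mul, ← Finset.sum_const]
    refine Finset.sum_le_sum fun S hS => ?_
    rw [Finset.mul_sum]
    refine (Finset.sum_le_sum fun T hT => hpair S hS T hT).trans ?_
    rw [Finset.sum_add_distrib, Finset.sum_add_distrib, Finset.sum_ite_eq, if_pos hS,
      Finset.sum_const, nsmul_eq_mul, ← Finset.mul_sum]
    gcongr
    exact hmiss S hS
  have hcheb := card_forall_notMem_mul_sq_le s C hCc (hamiltonFreeFamilies F n)
    fun A hA S hS h => (Finset.mem_filter.1 hA).2 S hS (Finset.mem_filter.1 h).2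
  set b : ℝ := ((hamiltonFreeFamilies F n).card : ℝ) with hb
  have hb0 : 0 ≤ b := Nat.cast_nonneg _
  set M : ℝ := (s.card : ℝ)
  have h23 : (2 : ℝ) ^ n ≤ 3 ^ n := pow_le_pow_left₀ (by norm_num) (by norm_num) n
  have hmain : b * M ≤ N * ((Fintype.card F + 2) * 3 ^ n) := by
    have h1 : b * M * (M * c ^ 2) ≤ N * ((Fintype.card F + 2) * 3 ^ n) * (M * c ^ 2) :=
      calc b * M * (M * c ^ 2) = b * (M * c) ^ 2 := by ring
        _ ≤ N * (M * (N * c + (M * c ^ 2 + 2 * c ^ 2 * 3 ^ n)) - (M * c) ^ 2) := by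
            refine hcheb.trans (mul_le_mul_of_nonneg_left ?_ hN0.le)
            linarith
        -- The leading term `(M * c) ^ 2` of the second moment cancels the squared mean, leaving the
        -- diagonal and the correlation excess.
        _ = N * (M * c) * (N + 2 * c * 3 ^ n) := by ring
        _ ≤ N * (M * c) * (c * (Fintype.card F * 3 ^ n) + 2 * c * 3 ^ n) := by
            refine mul_le_mul_of_nonneg_left (add_le_add_left (hNc.trans ?_) _) (by positivity)
            gcongr
        _ = _ := by ring
    exact le_of_mul_le_mul_right h1 (by positivity)
  have h4 : (4 : ℝ) ^ n ≤ M * (4 * n) := by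
    have := four_pow_le_four_mul_choose hn
    rwa [← hM] at this
  have h5 : b * 4 ^ n ≤ N * ((Fintype.card F + 2) * 3 ^ n) * (4 * n) :=
    calc b * 4 ^ n ≤ b * (M * (4 * n)) := mul_le_mul_of_nonneg_left h4 hb0
      _ = b * M * (4 * n) := by ring
      _ ≤ _ := mul_le_mul_of_nonneg_right hmain (by positivity)
  rw [div_pow]
  rw [← le_div_iff₀ (by positivity)] at h5
  refine h5.trans (le_of_eq ?_)
  field_simp

/-- Working with `2 * n - 1` vectors gives the strict inequality; `0 < n` is needed because the
subtraction truncates. -/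
theorem circuitTime_lt_of_notMem_hamiltonFreeFamilies {F : Type*} [Field F] [Fintype F] {n : ℕ}
    (hn : 0 < n) (w : ℕ → Fin n → F)
    (hw : (fun i : Fin (2 * n - 1) => w i) ∉ hamiltonFreeFamilies F n) :
    circuitTime w n < ((2 * n : ℕ) : ℕ∞) := by
  classical
  have hex : ∃ S : Finset (Fin (2 * n - 1)), S.card = n ∧
      IsCircuitOn F (fun i : Fin (2 * n - 1) => w i) (S : Set (Fin (2 * n - 1))) := by
    by_contra! h
    refine hw (Finset.mem_filter.2 ⟨Finset.mem_univ _, fun S hS => h S ?_⟩)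
    exact (Finset.mem_powersetCard.1 hS).2
  obtain ⟨S, hcard, hS⟩ := hex
  have h1 : circuitTime w n ≤ ((2 * n - 1 : ℕ) : ℕ∞) :=
    iInf₂_le (2 * n - 1) ⟨(S : Set (Fin (2 * n - 1))),
      (Matrix.columnMatroid_isCircuit_iff _ _).2 hS, by rw [Set.ncard_coe_finset, hcard]⟩
  exact h1.trans_lt (by exact_mod_cast (by omega : 2 * n - 1 < 2 * n))

theorem tendsto_measure_hamiltonCircuit {F : Type*} [Field F] [Fintype F]
    [MeasurableSpace F] [MeasurableSingletonClass F]
    {Ω : ℕ → Type*} [∀ n, MeasurableSpace (Ω n)]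
    (P : ∀ n, Measure (Ω n)) [∀ n, IsProbabilityMeasure (P n)]
    (v : ∀ n, ℕ → Ω n → (Fin n → F))
    (hlaw : ∀ n i, HasLaw (v n i) (uniformOn Set.univ) (P n))
    (hindep : ∀ n, iIndepFun (v n) (P n)) :
    Tendsto (fun n : ℕ => P n {ω | circuitTime (fun i => v n i ω) n < ((2 * n : ℕ) : ℕ∞)})
      atTop (𝓝 1) := by
  refine tendsto_measure_one_of_card_le hlaw hindep _ (fun n => 2 * n - 1)
    (hamiltonFreeFamilies F) (fun n => (Fintype.card F + 2) * (4 * n) * (3 / 4) ^ n) ?_ ?_ ?_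
  · filter_upwards [eventually_gt_atTop 0] with n hn ω hω
    exact circuitTime_lt_of_notMem_hamiltonFreeFamilies hn (fun i => v n i ω) hω
  · filter_upwards [eventually_gt_atTop 0] with n hn
    exact card_hamiltonFreeFamilies_le F hn
  · have h := (tendsto_self_mul_const_pow_of_lt_one (r := (3 / 4 : ℝ)) (by norm_num)
      (by norm_num)).const_mul (((Fintype.card F : ℝ) + 2) * 4)
    rw [mul_zero] at h
    exact h.congr fun n => by ring

theorem mainTheorem7 {F : Type*} [Field F] [Fintype F]
    [MeasurableSpace F] [MeasurableSingletonClass F]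
    {Ω : ℕ → Type*} [∀ n, MeasurableSpace (Ω n)]
    (P : ∀ n, Measure (Ω n)) [∀ n, IsProbabilityMeasure (P n)]
    (v : ∀ n, ℕ → Ω n → (Fin n → F))
    (hlaw : ∀ n i, HasLaw (v n i) (uniformOn Set.univ) (P n))
    (hindep : ∀ n, iIndepFun (v n) (P n)) :
    (∀ ε : ℝ, 0 < ε →
      Tendsto (fun n : ℕ => P n {ω | ∃ (m : ℕ) (C : Set (Fin m)),
          IsFirstCircuit (fun i => v n i ω) m C ∧
          |(C.ncard : ℝ) - (1 - (Fintype.card F : ℝ)⁻¹) * n|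
            ≤ ε * ((1 - (Fintype.card F : ℝ)⁻¹) * n)})
        atTop (𝓝 1)) ∧
    Tendsto (fun n : ℕ => P n {ω | circuitTime (fun i => v n i ω) n < ((2 * n : ℕ) : ℕ∞)})
      atTop (𝓝 1) :=
  ⟨fun _ hε => tendsto_measure_firstCircuit P v hlaw hindep hε,
    tendsto_measure_hamiltonCircuit P v hlaw hindep⟩
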